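/- Let $H^2(\mathbb D)$ be the Hardy space of the unit disc. For nonzero $\alpha,\beta\in\mathbb C$ with $|\alpha|^2+|\beta|^2=1$, let $H^2_{\alpha,\beta}=\overline{\operatorname{span}}\{\alpha+\beta z,\ z^n : n\ge 2\}\subseteq H^2(\mathbb D)$ and let $S_{\alpha,\beta}=P_{H^2_{\alpha,\beta}}M_z|_{H^2_{\alpha,\beta}}$ be the compression to $H^2_{\alpha,\beta}$ of the multiplication operator $M_z$ on $H^2(\mathbb D)$. For a closed $S_{\alpha,\beta}$-invariant subspace $\mathcal M\subseteq H^2_{\alpha,\beta}$, an inner function $\theta$ is said to be associated with $\mathcal M$ if $\mathcal M\cap z^2H^2(\mathbb D)=z^2\theta H^2(\mathbb D)$. For $E\subseteq H^2_{\alpha,\beta}$, let $[E]_{S_{\alpha,\beta}}$ denote the closed linear span of $\{S_{\alpha,\beta}^n f : f\in E,\ n\ge 0\}$. The polynomial $z^3+7z^2+12z-1$ has exactly one real root $\gamma$. Let $\alpha,\beta$ be as above, let $a\in\mathbb C$ with $0<|a|<1$ and $a\ne\alpha\bar\beta$, and let $\mathcal M\subseteq H^2_{\alpha,\beta}$ be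 a closed $S_{\alpha,\beta}$-invariant subspace with associated inner function $\theta(z)=\dfrac{z-a}{1-\bar a z}$. If $\mathcal M\ne[\mathcal M\ominus S_{\alpha,\beta}\mathcal M]_{S_{\alpha,\beta}}$ (that is, $\mathcal M$ fails the wandering subspace property), then $$|\beta|^2<\frac{1}{4+\gamma}.$$ -/

import Mathlib

open Set Metric

noncomputable section

/-- The Hardy space `H²(𝔻)`: the Hilbert space of power series with square-summable coefficients.
An element `f` is recorded by its Taylor coefficients `f 0, f 1, f 2, …`, with the `ℓ²` inner
product; the analytic function on the open unit disc that it represents is `HardyH2.eval f`. -/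
abbrev HardyH2 : Type := lp (fun _ : ℕ => ℂ) 2

namespace HardyH2

/-- The value at `w` (meaningful for `‖w‖ < 1`) of the analytic function `f`. -/
def eval (f : HardyH2) (w : ℂ) : ℂ := ∑' n : ℕ, f n * w ^ n

/-- The power series of `f` converges at every point of the open unit disc. -/
theorem hasSum_eval (f : HardyH2) {w : ℂ} (hw : w ∈ ball (0 : ℂ) 1) :
    HasSum (fun n : ℕ => f n * w ^ n) (eval f w) := by
  have hw1 : ‖w‖ < 1 := by simpa using hw
  refine Summable.hasSum (Summable.of_norm_bounded (g := fun n => ‖f‖ * ‖w‖ ^ n)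
    ((summable_geometric_of_lt_one (norm_nonneg w) hw1).mul_left _) fun n => ?_)
  rw [norm_mul, norm_pow]
  gcongr
  exact lp.norm_apply_le_norm (by norm_num) f n

/-- An element of `H²(𝔻)` is determined by the analytic function that it represents. -/
theorem ext_eval {f g : HardyH2} (h : ∀ w ∈ ball (0 : ℂ) 1, eval f w = eval g w) : f = g := by
  have key : ∀ k : HardyH2, HasFPowerSeriesAt (eval k)
      (FormalMultilinearSeries.ofScalars ℂ (fun n : ℕ => k n)) 0 := by
    intro k
    rw [hasFPowerSeriesAt_iff]
    filter_upwards [ball_mem_nhds (0 : ℂ) one_pos] with w hw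
    simpa [mul_comm] using hasSum_eval k hw
  have h2 := (key f).eq_formalMultilinearSeries_of_eventually (key g) (by
    filter_upwards [ball_mem_nhds (0 : ℂ) one_pos] with w hw using h w hw)
  ext n
  have h3 := congrArg (fun p => FormalMultilinearSeries.coeff p n) h2
  simpa using h3

/-- The monomial `z ^ n`. -/
def monomial (n : ℕ) : HardyH2 := lp.single 2 n (1 : ℂ)

/-- The coefficients of `z f(z)`. -/
def shiftCoeff (f : ℕ → ℂ) : ℕ → ℂ
  | 0 => 0
  | n + 1 => f n

theorem hasSum_shiftCoeff (f : HardyH2) :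
    HasSum (fun n => ‖shiftCoeff f n‖ ^ (2 : ENNReal).toReal) (‖f‖ ^ (2 : ENNReal).toReal) := by
  rw [← hasSum_nat_add_iff' 1]
  simpa [shiftCoeff] using lp.hasSum_norm (p := 2) (by norm_num) f

theorem memℓp_shiftCoeff (f : HardyH2) : Memℓp (shiftCoeff f) 2 :=
  memℓp_gen (hasSum_shiftCoeff f).summable

/-- The unilateral shift `M_z` on `H²(𝔻)`, as a linear isometry. -/
def mulZIsometry : HardyH2 →ₗᵢ[ℂ] HardyH2 where
  toFun f := ⟨shiftCoeff f, memℓp_shiftCoeff f⟩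
  map_add' f g := by
    ext n
    cases n <;> simp only [lp.coeFn_add, Pi.add_apply] <;> simp [shiftCoeff]
  map_smul' c f := by
    ext n
    cases n <;> simp [shiftCoeff]
  norm_map' f := by
    have h1 := lp.hasSum_norm (p := 2) (by norm_num)
      (⟨shiftCoeff f, memℓp_shiftCoeff f⟩ : HardyH2)
    have h2 := h1.unique (hasSum_shiftCoeff f)
    simpa using h2

/-- The unilateral shift `M_z` on `H²(𝔻)`. -/
def mulZ : HardyH2 →L[ℂ] HardyH2 := mulZIsometry.toContinuousLinearMap

/-- `mulZ` is multiplication by the coordinate function. -/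
theorem eval_mulZ (f : HardyH2) {w : ℂ} (hw : w ∈ ball (0 : ℂ) 1) :
    eval (mulZ f) w = w * eval f w := by
  refine (hasSum_eval (mulZ f) hw).unique ?_
  rw [← hasSum_nat_add_iff' 1]
  have h := (hasSum_eval f hw).mul_left w
  have h0 : (mulZ f : ℕ → ℂ) 0 = 0 := rfl
  have h1 : ∀ n, (mulZ f : ℕ → ℂ) (n + 1) = f n := fun _ => rfl
  simp only [h1, Finset.range_one, Finset.sum_singleton, h0, zero_mul, sub_zero]
  have h2 : (fun n => f n * w ^ (n + 1)) = fun n => w * (f n * w ^ n) := by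
    funext n
    ring
  simpa only [h2] using h

/-- The set `z² θ H²(𝔻)`, for a function `θ` on the disc. -/
def zSqMul (θ : ℂ → ℂ) : Set HardyH2 :=
  {F | ∃ h : HardyH2, ∀ w ∈ ball (0 : ℂ) 1, eval F w = w ^ 2 * θ w * eval h w}

/-- The space `H²_{α,β}`, the closed linear span of `α + β z` and the `z ^ n`, `n ≥ 2`. -/
def parametric (α β : ℂ) : Submodule ℂ HardyH2 :=
  (Submodule.span ℂ ({α • monomial 0 + β • monomial 1} ∪ {F | ∃ n : ℕ, 2 ≤ n ∧ F = monomial n})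
    ).topologicalClosure

instance (α β : ℂ) : CompleteSpace (parametric α β) :=
  inferInstanceAs (CompleteSpace (Submodule.topologicalClosure _))

/-- The operator `S_{α,β}`: the compression of the shift `M_z` to `H²_{α,β}`. -/
def compressedShift (α β : ℂ) : parametric α β →L[ℂ] parametric α β :=
  (parametric α β).orthogonalProjectionOnto ∘L mulZ ∘L (parametric α β).subtypeL

/-- The inner function associated with an `S_{α,β}`-invariant subspace `M`: `θ` is associated
with `M` if the functions in `M` of the form `z² g`, `g ∈ H²(𝔻)`, make up exactly
`z² θ H²(𝔻)`. -/
def IsAssociatedInner {α β : ℂ} (M : Submodule ℂ (parametric α β)) (θ : ℂ → ℂ) : Prop :=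
  {F : HardyH2 | F ∈ M.map (parametric α β).subtype ∧ F ∈ zSqMul (fun _ => 1)} = zSqMul θ

end HardyH2

/-- `[E]_T`, the smallest closed `T`-invariant subspace containing `E`: the closed linear span of
the vectors `T ^ n f`, `f ∈ E`, `n ≥ 0`. -/
def closedInvariantSpan {H : Type*} [NormedAddCommGroup H] [InnerProductSpace ℂ H]
    (T : H →L[ℂ] H) (E : Set H) : Submodule ℂ H :=
  (Submodule.span ℂ {x | ∃ f ∈ E, ∃ n : ℕ, x = (T ^ n) f}).topologicalClosure

/-- The wandering subspace `M ⊖ T M`. -/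
def wanderingSubspace {H : Type*} [NormedAddCommGroup H] [InnerProductSpace ℂ H]
    (T : H →L[ℂ] H) (M : Submodule ℂ H) : Submodule ℂ H :=
  M ⊓ (M.map (T : H →ₗ[ℂ] H))ᗮ

/-- The wandering subspace property of `M`: `M = [M ⊖ T M]_T`. -/
def HasWanderingSubspaceProperty {H : Type*} [NormedAddCommGroup H] [InnerProductSpace ℂ H]
    (T : H →L[ℂ] H) (M : Submodule ℂ H) : Prop :=
  M = closedInvariantSpan T (wanderingSubspace T M : Set H)

end

noncomputable section

/-! Write `b = |β|²`, `l = α conj β`, `J g = z² θ g`, so that `J` intertwines the shift with `S =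
S_{α,β}`. If `M` lies in `z² H²`, then `M` is the range of `J`, a copy of the unilateral shift, and
`J 1` generates it. Otherwise `M = ℂ f ⊕ J H²` with `f = α + βz + c z² / (1 - conj a z)`, and
invariance fixes `c` and gives `S f = l f + h₀ J 1` with `h₀ = c - conj a β ≠ 0`.

In the second case an explicit wandering vector `w` satisfies `(S - l) w = A J(1 - μz)`, where `A ≠
0`. When `|μ| ≤ 1` the function `1 - μz` is cyclic for the shift, so `w` generates `J H²`, then `f`,
hence `M` (`hasWanderingSubspaceProperty_of_span`). The condition `|μ| ≤ 1` reads `‖f‖² |l|(1 - |l|)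
≤ |h₀|²`, and `norm_sq_mul_le` deduces it from `|l|(1 - |l|) ≤ b`, whatever `a` is.

Failure of the wandering subspace property therefore forces `b < |l|(1 - |l|)`. Since `|l|² = b(1 -
b)`, this becomes a cubic inequality in `1/b - 4`, and `γ` is the root of that cubic. -/

/-! ### The cubic and the numerical bound -/

theorem cubic_lt_of_nonpos {y : ℝ} (hy : y ≤ 0) : y ^ 3 + 7 * y ^ 2 + 12 * y - 1 < 0 := by
  -- The cubic is `y(y+3)(y+4) - 1`, and the product is nonpositive for `y ≤ -4` and on `[-3, 0]`.
  rcases le_total y (-4) with h | h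
  · nlinarith [mul_nonneg (mul_nonneg (sub_nonneg.2 h) (by linarith : 0 ≤ -3 - y)) (neg_nonneg.2 hy)]
  rcases le_total y (-3) with h' | h'
  -- On `[-4, -3]` the cubic equals `-(2y+7)² - (y+4)²(-3-y)`, and the two terms have no common
  -- zero.
  · nlinarith [mul_nonneg (mul_nonneg (by linarith : 0 ≤ y + 4) (by linarith : 0 ≤ -3 - y))
      (by linarith : 0 ≤ y + 4), sq_nonneg (2 * y + 7)]
  · nlinarith [mul_nonneg (mul_nonneg (by linarith : 0 ≤ y + 4) (by linarith : 0 ≤ y + 3))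
      (neg_nonneg.2 hy)]

theorem cubic_strictMonoOn :
    StrictMonoOn (fun y : ℝ => y ^ 3 + 7 * y ^ 2 + 12 * y - 1) (Ici 0) := by
  intro x hx y _ hxy
  have hx : 0 ≤ x := hx
  have h1 := pow_le_pow_left₀ hx hxy.le 3
  have h2 := pow_le_pow_left₀ hx hxy.le 2
  simp only
  linarith

theorem exists_cubic_root : ∃ γ : ℝ, 0 < γ ∧ γ ^ 3 + 7 * γ ^ 2 + 12 * γ - 1 = 0 := by
  have hc : ContinuousOn (fun y : ℝ => y ^ 3 + 7 * y ^ 2 + 12 * y - 1) (Icc 0 1) := by fun_prop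
  obtain ⟨γ, -, h⟩ := intermediate_value_Icc zero_le_one hc
    (show (0 : ℝ) ∈ Icc _ _ by norm_num)
  refine ⟨γ, not_le.1 fun hle => (cubic_lt_of_nonpos hle).ne h, h⟩

theorem cubic_eq_zero_iff {γ : ℝ} (hγ : 0 < γ) (h : γ ^ 3 + 7 * γ ^ 2 + 12 * γ - 1 = 0)
    (y : ℝ) : y ^ 3 + 7 * y ^ 2 + 12 * y - 1 = 0 ↔ y = γ := by
  refine ⟨fun hy => ?_, fun hy => hy ▸ h⟩
  have hy0 : 0 < y := not_le.1 fun hle => (cubic_lt_of_nonpos hle).ne hy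
  exact cubic_strictMonoOn.injOn hy0.le hγ.le (hy.trans h.symm)

/-- Substituting `l² = b(1-b)` turns `hlt` into `b(2-b) < l`. Squaring removes `l`, and division by
`b³` gives positivity of the cubic at `1/b - 4`, which must then exceed its only root. -/
theorem lt_one_div_of_lt_mul_one_sub {γ b l : ℝ} (hγ : 0 < γ)
    (h : γ ^ 3 + 7 * γ ^ 2 + 12 * γ - 1 = 0) (hb : 0 < b) (hb1 : b < 1)
    (hlb : l ^ 2 = b * (1 - b)) (hlt : b < l * (1 - l)) : b < 1 / (4 + γ) := by
  have h1 : b * (2 - b) < l := by nlinarith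
  have h2 : (b * (2 - b)) ^ 2 < b * (1 - b) := by
    rw [← hlb]
    exact pow_lt_pow_left₀ h1 (by nlinarith) two_ne_zero
  have h3 : b * (2 - b) ^ 2 < 1 - b := by
    refine lt_of_mul_lt_mul_left ?_ hb.le
    linarith
  rw [lt_one_div hb (by linarith)]
  have h4 : 0 < (1 / b - 4) ^ 3 + 7 * (1 / b - 4) ^ 2 + 12 * (1 / b - 4) - 1 := by
    have : (1 / b - 4) ^ 3 + 7 * (1 / b - 4) ^ 2 + 12 * (1 / b - 4) - 1
        = (1 - b - b * (2 - b) ^ 2) / b ^ 3 := by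
      field_simp
      ring
    rw [this]
    exact div_pos (by linarith) (by positivity)
  by_contra hcon
  have hle : 1 / b - 4 ≤ γ := by linarith
  have h0 : 0 ≤ 1 / b - 4 := by
    by_contra hneg
    exact absurd (cubic_lt_of_nonpos (not_le.1 hneg).le) (not_lt.2 h4.le)
  have := cubic_strictMonoOn.monotoneOn h0 hγ.le hle
  simp only [h] at this
  linarith

/-! ### The shift on `H²` and its cyclic vectors -/

namespace HardyH2

open ComplexConjugate

@[simp] theorem mulZ_apply_zero (f : HardyH2) : mulZ f 0 = 0 := rfl

@[simp] theorem mulZ_apply_succ (f : HardyH2) (n : ℕ) : mulZ f (n + 1) = f n := rfl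

theorem monomial_apply (n k : ℕ) : monomial n k = if k = n then 1 else 0 := by
  rw [monomial, lp.single_apply, Pi.single_apply]

theorem inner_monomial_left (n : ℕ) (f : HardyH2) : inner ℂ (monomial n) f = f n := by
  rw [monomial, lp.inner_single_left]
  simp

theorem inner_monomial_right (f : HardyH2) (n : ℕ) : inner ℂ f (monomial n) = conj (f n) := by
  rw [← inner_conj_symm, inner_monomial_left]

theorem mulZ_monomial (n : ℕ) : mulZ (monomial n) = monomial (n + 1) := by
  ext k
  cases k <;> simp [monomial_apply]

theorem inner_mulZ_mulZ (f g : HardyH2) : inner ℂ (mulZ f) (mulZ g) = inner ℂ f g :=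
  mulZIsometry.inner_map_map f g

theorem norm_mulZ_le : ‖mulZ‖ ≤ 1 := mulZIsometry.norm_toContinuousLinearMap_le

/-- A shift-invariant closed subspace that contains `1 - μ z`, `|μ| ≤ 1`, is all of `H²`. -/
theorem eq_top_of_one_sub_mem {K : Submodule ℂ HardyH2} (hK : IsClosed (K : Set HardyH2))
    (hS : ∀ x ∈ K, mulZ x ∈ K) {μ : ℂ} (hμ : ‖μ‖ ≤ 1)
    (h : monomial 0 - μ • monomial 1 ∈ K) : K = ⊤ := by
  have : CompleteSpace K := hK.completeSpace_coe
  rw [← Submodule.orthogonal_eq_bot_iff, Submodule.eq_bot_iff]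
  intro v hv
  have hmem : ∀ n, monomial n - μ • monomial (n + 1) ∈ K := by
    intro n
    induction n with
    | zero => exact h
    | succ n ih =>
      have := hS _ ih
      rwa [map_sub, map_smul, mulZ_monomial, mulZ_monomial] at this
  have hrec : ∀ n, v n = conj μ * v (n + 1) := by
    intro n
    have := (Submodule.mem_orthogonal K v).1 hv _ (hmem n)
    rw [inner_sub_left, inner_smul_left, inner_monomial_left, inner_monomial_left] at this
    exact sub_eq_zero.1 this
  -- The recursion makes the moduli of the coefficients of `v` nondecreasing, while
  -- square-summability sends them to `0`.
  have hmono : Monotone fun n => ‖v n‖ := by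
    refine monotone_nat_of_le_succ fun n => ?_
    rw [hrec n, norm_mul, RCLike.norm_conj]
    exact mul_le_of_le_one_left (norm_nonneg _) hμ
  have hlim : Filter.Tendsto (fun n => ‖v n‖) Filter.atTop (nhds 0) := by
    have h1 := (lp.hasSum_norm (p := 2) (by norm_num) v).summable.tendsto_atTop_zero
    simp only [ENNReal.toReal_ofNat, Real.rpow_ofNat] at h1
    have h2 := h1.sqrt
    simpa [Real.sqrt_sq] using h2
  ext n
  simpa using hmono.ge_of_tendsto hlim n

theorem eval_add (f g : HardyH2) {w : ℂ} (hw : w ∈ ball (0 : ℂ) 1) :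
    eval (f + g) w = eval f w + eval g w := by
  refine (hasSum_eval (f + g) hw).unique ?_
  simpa [add_mul] using (hasSum_eval f hw).add (hasSum_eval g hw)

theorem eval_smul (c : ℂ) (f : HardyH2) {w : ℂ} (hw : w ∈ ball (0 : ℂ) 1) :
    eval (c • f) w = c * eval f w := by
  refine (hasSum_eval (c • f) hw).unique ?_
  simpa [mul_assoc] using (hasSum_eval f hw).mul_left c

theorem eval_sub (f g : HardyH2) {w : ℂ} (hw : w ∈ ball (0 : ℂ) 1) :
    eval (f - g) w = eval f w - eval g w := by
  have h := eval_add (f - g) g hw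
  rw [sub_add_cancel] at h
  rw [h, add_sub_cancel_right]

/-! ### Blaschke factor and Szegő kernel -/

/-- Multiplication by `(1 - conj a z)⁻¹`. -/
def mulSzego (a : ℂ) : HardyH2 →L[ℂ] HardyH2 := Ring.inverse (1 - conj a • mulZ)

theorem isUnit_one_sub_smul_mulZ {a : ℂ} (ha : ‖a‖ < 1) :
    IsUnit (1 - conj a • mulZ : HardyH2 →L[ℂ] HardyH2) := by
  refine isUnit_one_sub_of_norm_lt_one (lt_of_le_of_lt ?_ ha)
  rw [norm_smul, RCLike.norm_conj]
  exact mul_le_of_le_one_right (norm_nonneg _) norm_mulZ_le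

theorem mulSzego_sub {a : ℂ} (ha : ‖a‖ < 1) (x : HardyH2) :
    mulSzego a x - conj a • mulZ (mulSzego a x) = x := by
  simpa [mulSzego] using congrArg (fun A : HardyH2 →L[ℂ] HardyH2 => A x)
    (Ring.mul_inverse_cancel _ (isUnit_one_sub_smul_mulZ ha))

theorem mulSzego_of_sub {a : ℂ} (ha : ‖a‖ < 1) (x : HardyH2) :
    mulSzego a (x - conj a • mulZ x) = x := by
  simpa [mulSzego] using congrArg (fun A : HardyH2 →L[ℂ] HardyH2 => A x)
    (Ring.inverse_mul_cancel _ (isUnit_one_sub_smul_mulZ ha))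

theorem mulSzego_mulZ {a : ℂ} (ha : ‖a‖ < 1) (x : HardyH2) :
    mulSzego a (mulZ x) = mulZ (mulSzego a x) := by
  conv_lhs => rw [← mulSzego_sub ha x, map_sub, map_smul]
  exact mulSzego_of_sub ha _

/-- The `H²` form of `|z - a| = |1 - conj a z|` on the unit circle; it makes multiplication by the
Blaschke factor isometric. -/
theorem norm_mulZ_sub_smul (a : ℂ) (x : HardyH2) :
    ‖mulZ x - a • x‖ = ‖x - conj a • mulZ x‖ := by
  have hz : ‖mulZ x‖ = ‖x‖ := mulZIsometry.norm_map x
  have h : ‖mulZ x - a • x‖ ^ 2 = ‖x - conj a • mulZ x‖ ^ 2 := by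
    rw [@norm_sub_sq ℂ, @norm_sub_sq ℂ, norm_smul, norm_smul, RCLike.norm_conj, hz,
      inner_smul_right, inner_smul_right, ← inner_conj_symm x (mulZ x), ← map_mul,
      RCLike.conj_re]
  exact (sq_eq_sq₀ (norm_nonneg _) (norm_nonneg _)).1 h

/-- Multiplication by the Blaschke factor `(z - a) / (1 - conj a z)`. -/
def mulBlaschke (a : ℂ) (ha : ‖a‖ < 1) : HardyH2 →ₗᵢ[ℂ] HardyH2 where
  toLinearMap := ((mulZ - a • 1) ∘L mulSzego a : HardyH2 →L[ℂ] HardyH2)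
  norm_map' x := by
    have h := norm_mulZ_sub_smul a (mulSzego a x)
    rw [mulSzego_sub ha] at h
    simpa using h

theorem mulBlaschke_apply (a : ℂ) (ha : ‖a‖ < 1) (x : HardyH2) :
    mulBlaschke a ha x = mulZ (mulSzego a x) - a • mulSzego a x := rfl

theorem mulBlaschke_mulZ (a : ℂ) (ha : ‖a‖ < 1) (x : HardyH2) :
    mulBlaschke a ha (mulZ x) = mulZ (mulBlaschke a ha x) := by
  simp only [mulBlaschke_apply, mulSzego_mulZ ha, map_sub, map_smul]

theorem mulZ_sub_smul_eq_mulBlaschke (a : ℂ) (ha : ‖a‖ < 1) (x : HardyH2) :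
    mulZ x - a • x = mulBlaschke a ha (x - conj a • mulZ x) := by
  rw [mulBlaschke_apply, mulSzego_of_sub ha]

theorem eval_mulBlaschke (a : ℂ) (ha : ‖a‖ < 1) (x : HardyH2) {w : ℂ}
    (hw : w ∈ ball (0 : ℂ) 1) :
    eval (mulBlaschke a ha x) w = (w - a) / (1 - conj a * w) * eval x w := by
  have hne : 1 - conj a * w ≠ 0 := by
    intro h
    have h1 : ‖conj a * w‖ = 1 := by rw [← sub_eq_zero.1 h, norm_one]
    rw [norm_mul, RCLike.norm_conj] at h1
    have hw1 : ‖w‖ < 1 := by simpa using hw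
    nlinarith [norm_nonneg a, norm_nonneg w]
  have h1 : eval x w = (1 - conj a * w) * eval (mulSzego a x) w := by
    conv_lhs => rw [← mulSzego_sub ha x]
    rw [eval_sub _ _ hw, eval_smul _ _ hw, eval_mulZ _ hw]
    ring
  rw [mulBlaschke_apply, eval_sub _ _ hw, eval_smul _ _ hw, eval_mulZ _ hw, h1, ← mul_assoc, div_mul_cancel₀ _ hne]
  ring

theorem mem_zSqMul_one_iff (F : HardyH2) :
    F ∈ zSqMul (fun _ => 1) ↔ ∃ g, F = mulZ (mulZ g) := by
  refine exists_congr fun g => ⟨fun h => ext_eval fun w hw => ?_, ?_⟩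
  · rw [h w hw, eval_mulZ _ hw, eval_mulZ _ hw]
    ring
  · rintro rfl w hw
    rw [eval_mulZ _ hw, eval_mulZ _ hw]
    ring

theorem mem_zSqMul_blaschke_iff (a : ℂ) (ha : ‖a‖ < 1) (F : HardyH2) :
    F ∈ zSqMul (fun z => (z - a) / (1 - conj a * z)) ↔
      ∃ g, F = mulZ (mulZ (mulBlaschke a ha g)) := by
  refine exists_congr fun g => ⟨fun h => ext_eval fun w hw => ?_, ?_⟩
  · rw [h w hw, eval_mulZ _ hw, eval_mulZ _ hw, eval_mulBlaschke _ _ _ hw]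
    ring
  · rintro rfl w hw
    rw [eval_mulZ _ hw, eval_mulZ _ hw, eval_mulBlaschke _ _ _ hw]
    ring

/-- The Szegő kernel `(1 - conj a z)⁻¹`. -/
def szego (a : ℂ) : HardyH2 := mulSzego a (monomial 0)

theorem szego_sub {a : ℂ} (ha : ‖a‖ < 1) :
    szego a - conj a • mulZ (szego a) = monomial 0 := mulSzego_sub ha _

theorem inner_monomial_zero_mulZ (x : HardyH2) : inner ℂ (monomial 0) (mulZ x) = 0 := by
  rw [inner_monomial_left, mulZ_apply_zero]

/-- Pairing with the kernel is evaluation at `a`; equivalently, the kernel is an eigenvector of the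
backward shift. -/
theorem inner_szego_mulZ {a : ℂ} (ha : ‖a‖ < 1) (x : HardyH2) :
    inner ℂ (szego a) (mulZ x) = a * inner ℂ (szego a) x := by
  have h : szego a = monomial 0 + conj a • mulZ (szego a) :=
    sub_eq_iff_eq_add.1 (szego_sub ha)
  conv_lhs => rw [h]
  rw [inner_add_left, inner_monomial_zero_mulZ, inner_smul_left, inner_mulZ_mulZ, zero_add,
    Complex.conj_conj]

theorem inner_szego_mulBlaschke {a : ℂ} (ha : ‖a‖ < 1) (x : HardyH2) :
    inner ℂ (szego a) (mulBlaschke a ha x) = 0 := by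
  rw [mulBlaschke_apply, inner_sub_right, inner_szego_mulZ ha, inner_smul_right, sub_self]

theorem szego_zero {a : ℂ} (ha : ‖a‖ < 1) : szego a 0 = 1 := by
  have h := congrArg (fun x : HardyH2 => x 0) (szego_sub ha)
  simpa only [lp.coeFn_sub, lp.coeFn_smul, Pi.sub_apply, Pi.smul_apply, mulZ_apply_zero,
    smul_zero, sub_zero, monomial_apply, if_true] using h

theorem szego_succ {a : ℂ} (ha : ‖a‖ < 1) (n : ℕ) : szego a (n + 1) = conj a * szego a n := by
  have h := congrArg (fun x : HardyH2 => x (n + 1)) (szego_sub ha)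
  simp only [lp.coeFn_sub, lp.coeFn_smul, Pi.sub_apply, Pi.smul_apply, mulZ_apply_succ,
    smul_eq_mul, monomial_apply, Nat.succ_ne_zero, if_false] at h
  exact sub_eq_zero.1 h

/-- The Szegő kernel at `a` spans the orthogonal complement of the range of the Blaschke
factor. -/
theorem eq_smul_szego {a : ℂ} (ha : ‖a‖ < 1) {g : HardyH2}
    (hg : ∀ x, inner ℂ (mulBlaschke a ha x) g = 0) : g = g 0 • szego a := by
  have hrec : ∀ n, g (n + 1) = conj a * g n := by
    intro n
    -- The Blaschke factor sends `(1 - conj a z) zⁿ` to `(z - a) zⁿ`, so orthogonality becomes a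
    -- recursion on coefficients.
    have h := hg (monomial n - conj a • mulZ (monomial n))
    rw [← mulZ_sub_smul_eq_mulBlaschke, mulZ_monomial, inner_sub_left, inner_smul_left,
      inner_monomial_left, inner_monomial_left] at h
    exact sub_eq_zero.1 h
  ext n
  rw [lp.coeFn_smul, Pi.smul_apply, smul_eq_mul]
  induction n with
  | zero => rw [szego_zero ha, mul_one]
  | succ n ih =>
    rw [hrec, ih, szego_succ ha]
    ring

theorem norm_szego_sq {a : ℂ} (ha : ‖a‖ < 1) : ‖szego a‖ ^ 2 * (1 - ‖a‖ ^ 2) = 1 := by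
  have h := norm_mulZ_sub_smul a (szego a)
  have h1 : (inner ℂ (szego a) (szego a) : ℂ) * (1 - a * conj a) = 1 := by
    have h2 : inner ℂ (szego a) (szego a - conj a • mulZ (szego a)) = 1 := by
      rw [szego_sub ha, inner_monomial_right, szego_zero ha, map_one]
    rw [inner_sub_right, inner_smul_right, inner_szego_mulZ ha] at h2
    linear_combination h2
  rw [inner_self_eq_norm_sq_to_K, Complex.mul_conj, Complex.normSq_eq_norm_sq] at h1
  apply Complex.ofReal_injective
  push_cast
  simpa using h1

end HardyH2

/-! ### Wandering subspaces of the shift and of its rank-one extensions -/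

section WanderingSubspace

open ComplexConjugate HardyH2

variable {H : Type*} [NormedAddCommGroup H] [InnerProductSpace ℂ H]

theorem isClosed_closedInvariantSpan (T : H →L[ℂ] H) (E : Set H) :
    IsClosed (closedInvariantSpan T E : Set H) := Submodule.isClosed_topologicalClosure _

theorem subset_closedInvariantSpan (T : H →L[ℂ] H) {E : Set H} {x : H} (hx : x ∈ E) :
    x ∈ closedInvariantSpan T E :=
  Submodule.le_topologicalClosure _ (Submodule.subset_span ⟨x, hx, 0, by simp⟩)

theorem apply_mem_closedInvariantSpan (T : H →L[ℂ] H) {E : Set H} {x : H}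
    (hx : x ∈ closedInvariantSpan T E) : T x ∈ closedInvariantSpan T E := by
  refine map_mem_closure T.continuous hx fun y hy => ?_
  induction hy using Submodule.span_induction with
  | mem y hy =>
    obtain ⟨f, hf, n, rfl⟩ := hy
    exact Submodule.subset_span ⟨f, hf, n + 1, by rw [pow_succ']; rfl⟩
  | zero => simp
  | add y z _ _ hy hz => rw [map_add]; exact Submodule.add_mem _ hy hz
  | smul c y _ hy => rw [map_smul]; exact Submodule.smul_mem _ c hy

theorem closedInvariantSpan_le (T : H →L[ℂ] H) {E : Set H} {M : Submodule ℂ H}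
    (hM : IsClosed (M : Set H)) (hT : ∀ x ∈ M, T x ∈ M) (hE : E ⊆ M) :
    closedInvariantSpan T E ≤ M := by
  refine Submodule.topologicalClosure_minimal _ (Submodule.span_le.2 ?_) hM
  rintro _ ⟨f, hf, n, rfl⟩
  induction n with
  | zero => simpa using hE hf
  | succ n ih => rw [pow_succ']; exact hT _ ih

theorem hasWanderingSubspaceProperty_of_le {T : H →L[ℂ] H} {M : Submodule ℂ H}
    (hM : IsClosed (M : Set H)) (hT : ∀ x ∈ M, T x ∈ M)
    (h : M ≤ closedInvariantSpan T (wanderingSubspace T M : Set H)) :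
    HasWanderingSubspaceProperty T M :=
  le_antisymm h (closedInvariantSpan_le T hM hT inf_le_left)

theorem mem_wanderingSubspace_iff {T : H →L[ℂ] H} {M : Submodule ℂ H} {w : H} :
    w ∈ wanderingSubspace T M ↔ w ∈ M ∧ ∀ x ∈ M, inner ℂ (T x) w = 0 := by
  simp [wanderingSubspace, Submodule.mem_orthogonal]

variable {T : H →L[ℂ] H} {M : Submodule ℂ H} (J : HardyH2 →ₗᵢ[ℂ] H)

/-- If `J` intertwines the shift with `T`, a closed `T`-invariant subspace that contains
`J (1 - μ z)`, `|μ| ≤ 1`, contains the range of `J`. -/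
theorem range_mem_of_one_sub_mem (hJ : ∀ g, T (J g) = J (mulZ g))
    (hM : IsClosed (M : Set H)) (hT : ∀ x ∈ M, T x ∈ M) {μ : ℂ} (hμ : ‖μ‖ ≤ 1)
    (h : J (monomial 0 - μ • monomial 1) ∈ M) (g : HardyH2) : J g ∈ M := by
  have htop : M.comap J.toLinearMap = ⊤ :=
    eq_top_of_one_sub_mem (hM.preimage J.continuous)
      (fun x hx => by
        have := hT _ hx
        change T (J x) ∈ M at this
        rwa [hJ] at this) hμ h
  have : g ∈ M.comap J.toLinearMap := htop ▸ Submodule.mem_top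
  exact this

theorem hasWanderingSubspaceProperty_of_eq_range (hJ : ∀ g, T (J g) = J (mulZ g))
    (hM : IsClosed (M : Set H)) (hrange : ∀ x, x ∈ M ↔ ∃ g, x = J g) :
    HasWanderingSubspaceProperty T M := by
  have hT : ∀ x ∈ M, T x ∈ M := by
    intro x hx
    obtain ⟨g, rfl⟩ := (hrange x).1 hx
    exact (hrange _).2 ⟨mulZ g, hJ g⟩
  refine hasWanderingSubspaceProperty_of_le hM hT fun x hx => ?_
  obtain ⟨g, rfl⟩ := (hrange x).1 hx
  refine range_mem_of_one_sub_mem J hJ (isClosed_closedInvariantSpan _ _)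
    (fun x hx => apply_mem_closedInvariantSpan T hx) (μ := 0) (by simp) ?_ g
  rw [zero_smul, sub_zero]
  refine subset_closedInvariantSpan T (mem_wanderingSubspace_iff.2 ⟨(hrange _).2 ⟨_, rfl⟩, ?_⟩)
  intro y hy
  obtain ⟨g, rfl⟩ := (hrange y).1 hy
  rw [hJ, J.inner_map_map, inner_monomial_right, mulZ_apply_zero, map_zero]

/-- The wandering subspace property for a rank-one extension of a copy of the unilateral
shift. -/
theorem hasWanderingSubspaceProperty_of_span (hJ : ∀ g, T (J g) = J (mulZ g))
    (hM : IsClosed (M : Set H)) {f : H} {l h₀ : ℂ}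
    (hmem : ∀ x, x ∈ M ↔ ∃ (s : ℂ) (g : HardyH2), x = s • f + J g)
    (hf : ∀ g, inner ℂ (J g) f = 0) (hTf : T f = l • f + h₀ • J (monomial 0)) (hh₀ : h₀ ≠ 0)
    (hle : ‖f‖ ^ 2 * (‖l‖ * (1 - ‖l‖)) ≤ ‖h₀‖ ^ 2) :
    HasWanderingSubspaceProperty T M := by
  have hT : ∀ x ∈ M, T x ∈ M := by
    intro x hx
    obtain ⟨s, g, rfl⟩ := (hmem x).1 hx
    refine (hmem _).2 ⟨s * l, (s * h₀) • monomial 0 + mulZ g, ?_⟩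
    rw [map_add, map_smul, hJ, hTf, map_add, map_smul]
    module
  set N : ℂ := (‖f‖ : ℂ) ^ 2 with hN
  set C := closedInvariantSpan T (wanderingSubspace T M : Set H) with hC
  have hCT : ∀ x ∈ C, T x ∈ C := fun x hx => apply_mem_closedInvariantSpan T hx
  have hff : inner ℂ f f = N := inner_self_eq_norm_sq_to_K f
  -- A combination of `f` and `J 1` is orthogonal to every `T (J g) = J (z g)`; the coefficients are
  -- chosen to make it orthogonal to `T f` as well.
  set w : H := conj h₀ • f - (conj l * N) • J (monomial 0) with hw
  have hwC : w ∈ C := by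
    refine subset_closedInvariantSpan T (mem_wanderingSubspace_iff.2 ⟨(hmem _).2
      ⟨conj h₀, -(conj l * N) • monomial 0, ?_⟩, ?_⟩)
    · rw [map_smul, neg_smul, ← sub_eq_add_neg]
    · intro x hx
      obtain ⟨s, g, rfl⟩ := (hmem x).1 hx
      have hfJ : inner ℂ f (J (monomial 0)) = 0 := by
        rw [← inner_conj_symm, hf, map_zero]
      rw [map_add, map_smul, hJ, hTf, hw]
      simp only [inner_add_left, inner_sub_right, inner_smul_left, inner_smul_right, hf, hfJ,
        hff, J.inner_map_map, inner_monomial_right, mulZ_apply_zero, monomial_apply, map_zero,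
        if_true, map_one]
      ring
  set A : ℂ := conj h₀ * h₀ + conj l * l * N with hA
  have hAr : A = ((‖h₀‖ ^ 2 + ‖l‖ ^ 2 * ‖f‖ ^ 2 : ℝ) : ℂ) := by
    rw [hA, hN, Complex.conj_mul', Complex.conj_mul']
    push_cast
    rfl
  have hpos : 0 < ‖h₀‖ ^ 2 + ‖l‖ ^ 2 * ‖f‖ ^ 2 := by
    have := norm_pos_iff.2 hh₀
    positivity
  have hA0 : A ≠ 0 := by
    rw [hAr]
    exact_mod_cast hpos.ne'
  have hJC : ∀ g, J g ∈ C := by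
    refine range_mem_of_one_sub_mem J hJ (isClosed_closedInvariantSpan _ _) hCT
      -- The ratio of the coefficients of `J z` and `J 1` in `-(T - l) w` and `(T - l) w`. The bound
      -- `|μ| ≤ 1` is exactly `hle`.
      (μ := conj l * N / A) ?_ ?_
    · rw [norm_div, norm_mul, RCLike.norm_conj, hAr, Complex.norm_real, hN, norm_pow,
        Complex.norm_real, norm_norm, Real.norm_of_nonneg hpos.le, div_le_one hpos]
      linarith
    · have h1 : A⁻¹ • (T w - l • w) ∈ C :=
        C.smul_mem _ (C.sub_mem (hCT _ hwC) (C.smul_mem _ hwC))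
      have h2 : T w - l • w = A • J (monomial 0) - (conj l * N) • J (monomial 1) := by
        rw [hw, map_sub, T.map_smul, T.map_smul, hJ, hTf, mulZ_monomial, hA]
        module
      convert h1 using 1
      rw [h2, map_sub, J.map_smul, smul_sub, inv_smul_smul₀ hA0, smul_smul, div_eq_inv_mul]
  -- Since `h₀ ≠ 0`, `f` can be recovered from `w` modulo the range of `J`.
  have hfC : f ∈ C := by
    have h1 := C.smul_mem (conj h₀)⁻¹ (C.add_mem hwC (C.smul_mem (conj l * N) (hJC (monomial 0))))
    rwa [hw, sub_add_cancel, inv_smul_smul₀ ((map_ne_zero _).2 hh₀)] at h1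
  refine hasWanderingSubspaceProperty_of_le hM hT fun x hx => ?_
  obtain ⟨s, g, rfl⟩ := (hmem x).1 hx
  exact C.add_mem (C.smul_mem s hfC) (hJC g)

end WanderingSubspace

/-! ### The space `H²_{α,β}` and its compressed shift -/

namespace HardyH2

open ComplexConjugate

theorem mulZ_mulZ_mem_parametric (α β : ℂ) (g : HardyH2) :
    mulZ (mulZ g) ∈ parametric α β := by
  have hcl : IsClosed (((parametric α β).comap (mulZ : HardyH2 →ₗ[ℂ] HardyH2)).comap
      (mulZ : HardyH2 →ₗ[ℂ] HardyH2) : Set HardyH2) :=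
    (Submodule.isClosed_topologicalClosure _).preimage (mulZ.continuous.comp mulZ.continuous)
  refine hcl.mem_of_tendsto (lp.hasSum_single (by norm_num) g)
    (Filter.Eventually.of_forall fun s => Submodule.sum_mem _ fun n _ => ?_)
  have h1 : lp.single 2 n (g n) = g n • monomial n := by
    rw [monomial, ← lp.single_smul, smul_eq_mul, mul_one]
  rw [h1]
  refine Submodule.smul_mem _ _ ?_
  change mulZ (mulZ (monomial n)) ∈ parametric α β
  rw [mulZ_monomial, mulZ_monomial]
  exact Submodule.le_topologicalClosure _ (Submodule.subset_span (Or.inr ⟨n + 2, by omega, rfl⟩))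

/-- The isometry `g ↦ z² g` from `H²` into `H²_{α,β}`. -/
def mulZSq (α β : ℂ) : HardyH2 →ₗᵢ[ℂ] parametric α β where
  toLinearMap := ((mulZ ∘L mulZ : HardyH2 →L[ℂ] HardyH2) : HardyH2 →ₗ[ℂ] HardyH2).codRestrict
    (parametric α β) (mulZ_mulZ_mem_parametric α β)
  norm_map' g := (mulZIsometry.norm_map _).trans (mulZIsometry.norm_map g)

@[simp] theorem coe_mulZSq (α β : ℂ) (g : HardyH2) :
    (mulZSq α β g : HardyH2) = mulZ (mulZ g) := rfl

/-- The vector `α + β z` of `H²_{α,β}`. -/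
def linGen (α β : ℂ) : parametric α β :=
  ⟨α • monomial 0 + β • monomial 1,
    Submodule.le_topologicalClosure _ (Submodule.subset_span (Or.inl rfl))⟩

theorem coe_linGen (α β : ℂ) :
    (linGen α β : HardyH2) = α • monomial 0 + β • monomial 1 := rfl

theorem lin_apply (α β : ℂ) (n : ℕ) : (α • monomial 0 + β • monomial 1 : HardyH2) n =
    α * (if n = 0 then 1 else 0) + β * (if n = 1 then 1 else 0) := by
  rw [← monomial_apply, ← monomial_apply]
  rfl

/-- Orthogonality to `conj β - conj α z`: it holds on the generators and passes to the closure by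
continuity of `φ`. -/
theorem apply_zero_mul_eq_of_mem {α β : ℂ} {v : HardyH2} (hv : v ∈ parametric α β) :
    v 0 * β = v 1 * α := by
  let φ : HardyH2 →L[ℂ] ℂ := conj (conj β) • innerSL ℂ (monomial 0) -
    conj (conj α) • innerSL ℂ (monomial 1)
  have hφ : ∀ x : HardyH2, φ x = β * x 0 - α * x 1 := by
    intro x
    simp [φ, inner_monomial_left]
  have hle : parametric α β ≤ LinearMap.ker (φ : HardyH2 →ₗ[ℂ] ℂ) := by
    refine Submodule.topologicalClosure_minimal _ (Submodule.span_le.2 ?_) φ.isClosed_ker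
    rintro x (hx | ⟨n, hn, rfl⟩)
    · rw [mem_singleton_iff.1 hx]
      change φ _ = 0
      rw [hφ]
      simp [lin_apply, mul_comm]
    · change φ _ = 0
      rw [hφ, monomial_apply, monomial_apply, if_neg (by omega), if_neg (by omega)]
      ring
  have h : φ v = 0 := hle hv
  rw [hφ] at h
  linear_combination h

theorem exists_eq_mulZ_mulZ {v : HardyH2} (h0 : v 0 = 0) (h1 : v 1 = 0) :
    ∃ g, v = mulZ (mulZ g) := by
  have hmem : Memℓp (fun n => v (n + 2)) 2 := by
    have h := (lp.hasSum_norm (p := 2) (by norm_num) v).summable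
    exact memℓp_gen ((summable_nat_add_iff 2).2 h)
  refine ⟨⟨_, hmem⟩, ?_⟩
  ext n
  rcases n with _ | _ | n
  · exact h0
  · exact h1
  · rfl

theorem exists_eq_smul_linGen_add {α β : ℂ} (hβ : β ≠ 0) (v : parametric α β) :
    ∃ (s : ℂ) (g : HardyH2), v = s • linGen α β + mulZSq α β g := by
  have hv := apply_zero_mul_eq_of_mem v.2
  have hlin0 : (α • monomial 0 + β • monomial 1 : HardyH2) 0 = α := by simp [lin_apply]
  have hlin1 : (α • monomial 0 + β • monomial 1 : HardyH2) 1 = β := by simp [lin_apply]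
  obtain ⟨g, hg⟩ := exists_eq_mulZ_mulZ
    (v := (v : HardyH2) - ((v : HardyH2) 1 / β) • (α • monomial 0 + β • monomial 1))
    (by
      rw [lp.coeFn_sub, Pi.sub_apply, lp.coeFn_smul, Pi.smul_apply, hlin0, smul_eq_mul]
      field_simp
      linear_combination hv)
    (by
      rw [lp.coeFn_sub, Pi.sub_apply, lp.coeFn_smul, Pi.smul_apply, hlin1, smul_eq_mul,
        div_mul_cancel₀ _ hβ, sub_self])
  refine ⟨(v : HardyH2) 1 / β, g, Subtype.ext ?_⟩
  rw [Submodule.coe_add, Submodule.coe_smul, coe_linGen, coe_mulZSq, ← hg]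
  abel

theorem compressedShift_eq {α β : ℂ} (v u : parametric α β)
    (h : ∀ w ∈ parametric α β, inner ℂ (mulZ v - (u : HardyH2)) w = 0) :
    compressedShift α β v = u :=
  Subtype.ext (Submodule.eq_starProjection_of_mem_of_inner_eq_zero u.2 h)

theorem compressedShift_mulZSq (α β : ℂ) (g : HardyH2) :
    compressedShift α β (mulZSq α β g) = mulZSq α β (mulZ g) :=
  compressedShift_eq _ _ fun w _ => by simp

/-- In `z(α + βz) = αz + βz²` the second term already lies in the space, and `z` projects to `conj β
(α + βz)`. -/
theorem compressedShift_linGen {α β : ℂ} (hαβ : ‖α‖ ^ 2 + ‖β‖ ^ 2 = 1) :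
    compressedShift α β (linGen α β) =
      (α * conj β) • linGen α β + β • mulZSq α β (monomial 0) := by
  have hn : α * conj α + β * conj β = 1 := by
    rw [Complex.mul_conj', Complex.mul_conj']
    exact_mod_cast hαβ
  refine compressedShift_eq _ _ fun w hw => ?_
  have hv := apply_zero_mul_eq_of_mem hw
  have hv' := congrArg conj hv
  simp only [map_mul] at hv'
  simp only [coe_linGen, coe_mulZSq, Submodule.coe_add, Submodule.coe_smul, map_add,
    mulZ.map_smul, mulZ_monomial, inner_sub_left, inner_add_left, inner_smul_left,
    inner_monomial_left, map_mul, Complex.conj_conj]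
  linear_combination (-(conj α) * (w : HardyH2) 1) * hn - (conj α * conj α) * hv

theorem inner_mulZSq_linGen (α β : ℂ) (g : HardyH2) :
    inner ℂ (mulZSq α β g : HardyH2) (linGen α β : HardyH2) = 0 := by
  rw [coe_mulZSq, coe_linGen, inner_add_right, inner_smul_right, inner_smul_right,
    inner_monomial_right, inner_monomial_right, mulZ_apply_zero, mulZ_apply_succ _ 0,
    mulZ_apply_zero]
  simp

theorem norm_linGen_add_sq {α β : ℂ} (hαβ : ‖α‖ ^ 2 + ‖β‖ ^ 2 = 1) (g : HardyH2) :
    ‖linGen α β + mulZSq α β g‖ ^ 2 = 1 + ‖g‖ ^ 2 := by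
  have hn : ‖(linGen α β : HardyH2)‖ ^ 2 = 1 := by
    have h : inner ℂ (linGen α β : HardyH2) (linGen α β : HardyH2) = 1 := by
      conv_lhs => rw [coe_linGen]
      rw [inner_add_left, inner_smul_left, inner_smul_left, inner_monomial_left,
        inner_monomial_left, lin_apply, lin_apply]
      simp only [if_true, one_ne_zero, zero_ne_one, if_false, mul_one, mul_zero, add_zero,
        zero_add, Complex.conj_mul']
      exact_mod_cast hαβ
    rw [inner_self_eq_norm_sq_to_K] at h
    apply Complex.ofReal_injective
    simpa using h
  have h0 : inner ℂ (linGen α β : HardyH2) (mulZSq α β g : HardyH2) = 0 := by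
    rw [← inner_conj_symm, inner_mulZSq_linGen, map_zero]
  have h1 : ‖(mulZSq α β g : HardyH2)‖ = ‖g‖ := (mulZSq α β).norm_map g
  have h2 := norm_add_sq_eq_norm_sq_add_norm_sq_of_inner_eq_zero _ _ h0
  rw [← sq, ← sq, ← sq, hn, h1] at h2
  exact h2

/-! ### Invariant subspaces associated with a Blaschke factor -/

theorem IsAssociatedInner.mulZSq_mem_iff {α β a : ℂ} {M : Submodule ℂ (parametric α β)}
    (ha : ‖a‖ < 1) (h : IsAssociatedInner M (fun z => (z - a) / (1 - conj a * z)))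
    (g : HardyH2) : mulZSq α β g ∈ M ↔ ∃ x, g = mulBlaschke a ha x := by
  have h1 := Set.ext_iff.1 h (mulZSq α β g)
  rw [mem_ofPred_eq, mem_zSqMul_one_iff, mem_zSqMul_blaschke_iff a ha] at h1
  have hinj : Function.Injective fun x : HardyH2 => mulZ (mulZ x) :=
    mulZIsometry.injective.comp mulZIsometry.injective
  constructor
  · intro hg
    obtain ⟨x, hx⟩ := h1.1 ⟨⟨_, hg, rfl⟩, g, rfl⟩
    exact ⟨x, hinj hx⟩
  · rintro ⟨x, rfl⟩
    obtain ⟨⟨y, hy, hxy⟩, -⟩ := h1.2 ⟨x, rfl⟩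
    exact Subtype.ext hxy ▸ hy

/-- Multiplication by `z² (z - a) / (1 - conj a z)`, as an isometry of `H²` into
`H²_{α,β}`. -/
def mulZSqBlaschke (α β a : ℂ) (ha : ‖a‖ < 1) : HardyH2 →ₗᵢ[ℂ] parametric α β :=
  (mulZSq α β).comp (mulBlaschke a ha)

theorem mulZSqBlaschke_apply (α β a : ℂ) (ha : ‖a‖ < 1) (g : HardyH2) :
    mulZSqBlaschke α β a ha g = mulZSq α β (mulBlaschke a ha g) := rfl

theorem compressedShift_mulZSqBlaschke (α β a : ℂ) (ha : ‖a‖ < 1) (g : HardyH2) :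
    compressedShift α β (mulZSqBlaschke α β a ha g) = mulZSqBlaschke α β a ha (mulZ g) := by
  rw [mulZSqBlaschke_apply, mulZSqBlaschke_apply, compressedShift_mulZSq, mulBlaschke_mulZ]

/-- A vector of `M` outside of `z² H²` can be normalised to `α + β z + c z² / (1 - conj a z)`. -/
theorem exists_linGen_add_smul_szego_mem {α β a : ℂ} {M : Submodule ℂ (parametric α β)}
    (hβ : β ≠ 0) (ha : ‖a‖ < 1)
    (h : IsAssociatedInner M (fun z => (z - a) / (1 - conj a * z)))
    (hM : ¬ ∀ x ∈ M, ∃ g, x = mulZSq α β g) :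
    ∃ c : ℂ, linGen α β + mulZSq α β (c • szego a) ∈ M := by
  push Not at hM
  obtain ⟨m, hm, hm'⟩ := hM
  obtain ⟨s, g, rfl⟩ := exists_eq_smul_linGen_add hβ m
  have hs : s ≠ 0 := by
    rintro rfl
    exact hm' g (by simp)
  have hm1 : linGen α β + mulZSq α β (s⁻¹ • g) ∈ M := by
    have := M.smul_mem s⁻¹ hm
    rwa [smul_add, inv_smul_smul₀ hs, ← map_smul] at this
  let K := LinearMap.range (mulBlaschke a ha).toLinearMap
  have hK : IsClosed (K : Set HardyH2) := by
    have := (mulBlaschke a ha).isometry.isClosedEmbedding.isClosed_range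
    rwa [← LinearIsometry.coe_toLinearMap, ← LinearMap.coe_range] at this
  have : CompleteSpace K := hK.completeSpace_coe
  obtain ⟨y, ⟨x, rfl⟩, z, hz, hyz⟩ := K.exists_add_mem_mem_orthogonal (s⁻¹ • g)
  -- The part `z` of `s⁻¹ • g` orthogonal to the Blaschke range is a multiple of the kernel. The
  -- kernel has constant term `1`, so the multiple is `z 0`.
  refine ⟨z 0, ?_⟩
  rw [← eq_smul_szego ha fun x => (Submodule.mem_orthogonal K z).1 hz _ ⟨x, rfl⟩]
  have h2 := M.sub_mem hm1 ((h.mulZSq_mem_iff ha _).2 ⟨x, rfl⟩)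
  rw [hyz, map_add] at h2
  convert h2 using 1
  change _ = _ + (mulZSq α β (mulBlaschke a ha x) + _) - _
  abel

/-- The values forced on the coefficients by invariance of `M`. -/
theorem coeff_of_invariant {α β a c : ℂ} {M : Submodule ℂ (parametric α β)}
    (hαβ : ‖α‖ ^ 2 + ‖β‖ ^ 2 = 1) (ha : ‖a‖ < 1)
    (hT : ∀ f ∈ M, compressedShift α β f ∈ M)
    (h : IsAssociatedInner M (fun z => (z - a) / (1 - conj a * z)))
    (hc : linGen α β + mulZSq α β (c • szego a) ∈ M) :
    c * (α * conj β - a) = β * (1 - ‖a‖ ^ 2 : ℝ) ∧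
      compressedShift α β (linGen α β + mulZSq α β (c • szego a)) =
        (α * conj β) • (linGen α β + mulZSq α β (c • szego a)) +
          (c - conj a * β) • mulZSqBlaschke α β a ha (monomial 0) := by
  have hTf : compressedShift α β (linGen α β + mulZSq α β (c • szego a)) =
      (α * conj β) • (linGen α β + mulZSq α β (c • szego a)) +
        mulZSq α β (β • monomial 0 + c • mulZ (szego a) - (α * conj β * c) • szego a) := by
    rw [map_add, compressedShift_linGen hαβ, compressedShift_mulZSq]
    simp only [map_add, map_sub, map_smul]
    module
  have hmem := M.sub_mem (hT _ hc) (M.smul_mem (α * conj β) hc)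
  rw [hTf, add_sub_cancel_left] at hmem
  obtain ⟨x, hx⟩ := (h.mulZSq_mem_iff ha _).1 hmem
  -- By invariance `(S - l) f` lies in `z² θ H²`; after removing `z²` it vanishes at `a`, which is
  -- one linear equation for `c`.
  have hrel : c * (α * conj β - a) = β * (1 - ‖a‖ ^ 2 : ℝ) := by
    have h1 := inner_szego_mulBlaschke ha x
    rw [← hx, inner_sub_right, inner_add_right, inner_smul_right, inner_smul_right,
      inner_smul_right, inner_szego_mulZ ha, inner_monomial_right, szego_zero ha, map_one,
      inner_self_eq_norm_sq_to_K] at h1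
    have h2 : ((‖szego a‖ : ℂ) ^ 2) * (1 - ‖a‖ ^ 2 : ℝ) = 1 := by
      exact_mod_cast norm_szego_sq ha
    simp only [Complex.coe_algebraMap] at h1
    linear_combination (-(1 - ‖a‖ ^ 2 : ℝ) : ℂ) * h1 - c * (α * conj β - a) * h2
  refine ⟨hrel, ?_⟩
  rw [hTf, mulZSqBlaschke_apply, ← (mulZSq α β).map_smul]
  congr 2
  have haa : ((1 - ‖a‖ ^ 2 : ℝ) : ℂ) = 1 - a * conj a := by
    rw [Complex.mul_conj']
    push_cast
    rfl
  rw [haa] at hrel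
  have hB : mulBlaschke a ha (monomial 0) = mulZ (szego a) - a • szego a := rfl
  rw [hB, ← szego_sub ha]
  have e : α * conj β * c = a * c + β * (1 - a * conj a) := by linear_combination hrel
  rw [e]
  module

/-- After multiplication by `|l - a|²` the relation `hc` eliminates `c`, and both sides become
explicit in `|β|²`, `|a|²`, `|l|` and `|l - a|²`. -/
theorem norm_sq_mul_le {α β a c : ℂ} (hαβ : ‖α‖ ^ 2 + ‖β‖ ^ 2 = 1) (ha : ‖a‖ < 1)
    (hne : a ≠ α * conj β) (hc : c * (α * conj β - a) = β * (1 - ‖a‖ ^ 2 : ℝ))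
    (hb : ‖α * conj β‖ * (1 - ‖α * conj β‖) ≤ ‖β‖ ^ 2) :
    ‖linGen α β + mulZSq α β (c • szego a)‖ ^ 2 * (‖α * conj β‖ * (1 - ‖α * conj β‖)) ≤
      ‖c - conj a * β‖ ^ 2 := by
  set l := α * conj β with hl
  have hl2 : ‖l‖ ^ 2 = ‖β‖ ^ 2 * (1 - ‖β‖ ^ 2) := by
    rw [hl, norm_mul, RCLike.norm_conj, mul_pow, ← hαβ]
    ring
  have hl1 : ‖l‖ ≤ 1 := by nlinarith [norm_nonneg l, sq_nonneg (‖β‖ ^ 2 - 1 / 2)]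
  have hE : 0 < 1 - ‖a‖ ^ 2 := by nlinarith [norm_nonneg a]
  have hD : 0 < ‖l - a‖ ^ 2 := by
    have := norm_pos_iff.2 (sub_ne_zero.2 hne.symm)
    positivity
  have hk := norm_szego_sq ha
  have hcn : ‖c‖ ^ 2 * ‖l - a‖ ^ 2 = ‖β‖ ^ 2 * (1 - ‖a‖ ^ 2) ^ 2 := by
    rw [← mul_pow, ← norm_mul, hc, norm_mul, Complex.norm_real, mul_pow,
      Real.norm_of_nonneg hE.le]
  have hN : ‖linGen α β + mulZSq α β (c • szego a)‖ ^ 2 * ‖l - a‖ ^ 2 =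
      ‖l - a‖ ^ 2 + ‖β‖ ^ 2 * (1 - ‖a‖ ^ 2) := by
    rw [norm_linGen_add_sq hαβ, norm_smul, mul_pow]
    linear_combination ‖szego a‖ ^ 2 * hcn + ‖β‖ ^ 2 * (1 - ‖a‖ ^ 2) * hk
  have haa : ((1 - ‖a‖ ^ 2 : ℝ) : ℂ) = 1 - a * conj a := by
    rw [Complex.mul_conj']
    push_cast
    rfl
  have hh : (c - conj a * β) * (l - a) = β * (1 - conj a * l) := by
    rw [haa] at hc
    linear_combination hc
  have hpick : ‖1 - conj a * l‖ ^ 2 = ‖l - a‖ ^ 2 + (1 - ‖a‖ ^ 2) * (1 - ‖l‖ ^ 2) := by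
    simp only [← Complex.normSq_eq_norm_sq, Complex.normSq_apply, Complex.sub_re, Complex.sub_im,
      Complex.mul_re, Complex.mul_im, Complex.conj_re, Complex.conj_im, Complex.one_re,
      Complex.one_im]
    ring
  have hhn : ‖c - conj a * β‖ ^ 2 * ‖l - a‖ ^ 2 =
      ‖β‖ ^ 2 * (‖l - a‖ ^ 2 + (1 - ‖a‖ ^ 2) * (1 - ‖l‖ ^ 2)) := by
    rw [← hpick, ← mul_pow, ← mul_pow, ← norm_mul, ← norm_mul, hh]
  refine le_of_mul_le_mul_right ?_ hD
  rw [hhn, mul_right_comm, hN]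
  -- Right side minus left side is `|l-a|² (|β|² - |l|(1-|l|)) + |β|² (1-|a|²)(1-|l|)`.
  have h1 := mul_le_mul_of_nonneg_left hb hD.le
  have h2 : 0 ≤ ‖β‖ ^ 2 * (1 - ‖a‖ ^ 2) * (1 - ‖l‖) :=
    mul_nonneg (by positivity) (by linarith)
  nlinarith

theorem hasWanderingSubspaceProperty_of_norm_le {α β a : ℂ} (hβ : β ≠ 0)
    (hαβ : ‖α‖ ^ 2 + ‖β‖ ^ 2 = 1) (ha : ‖a‖ < 1) (hne : a ≠ α * conj β)
    {M : Submodule ℂ (parametric α β)} (hM : IsClosed (M : Set (parametric α β)))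
    (hT : ∀ f ∈ M, compressedShift α β f ∈ M)
    (h : IsAssociatedInner M (fun z => (z - a) / (1 - conj a * z)))
    (hb : ‖α * conj β‖ * (1 - ‖α * conj β‖) ≤ ‖β‖ ^ 2) :
    HasWanderingSubspaceProperty (compressedShift α β) M := by
  by_cases hsub : ∀ x ∈ M, ∃ g, x = mulZSq α β g
  · refine hasWanderingSubspaceProperty_of_eq_range (mulZSqBlaschke α β a ha)
      (compressedShift_mulZSqBlaschke α β a ha) hM fun x => ⟨fun hx => ?_, ?_⟩
    · obtain ⟨g, rfl⟩ := hsub x hx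
      obtain ⟨y, rfl⟩ := (h.mulZSq_mem_iff ha g).1 hx
      exact ⟨y, rfl⟩
    · rintro ⟨g, rfl⟩
      exact (h.mulZSq_mem_iff ha _).2 ⟨g, rfl⟩
  · obtain ⟨c, hc⟩ := exists_linGen_add_smul_szego_mem hβ ha h hsub
    obtain ⟨hrel, hTf⟩ := coeff_of_invariant hαβ ha hT h hc
    refine hasWanderingSubspaceProperty_of_span (mulZSqBlaschke α β a ha)
      (compressedShift_mulZSqBlaschke α β a ha) hM (fun x => ⟨fun hx => ?_, ?_⟩) (fun g => ?_) hTf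
      ?_ (norm_sq_mul_le hαβ ha hne hrel hb)
    · obtain ⟨s, g, rfl⟩ := exists_eq_smul_linGen_add hβ x
      have h1 := M.sub_mem hx (M.smul_mem s hc)
      have h2 : s • linGen α β + mulZSq α β g - s • (linGen α β + mulZSq α β (c • szego a)) =
          mulZSq α β (g - s • c • szego a) := by
        simp only [map_sub, map_smul]
        module
      rw [h2] at h1
      obtain ⟨y, hy⟩ := (h.mulZSq_mem_iff ha _).1 h1
      refine ⟨s, y, ?_⟩
      rw [mulZSqBlaschke_apply, ← hy, ← h2]
      abel
    · rintro ⟨s, g, rfl⟩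
      exact M.add_mem (M.smul_mem s hc) ((h.mulZSq_mem_iff ha _).2 ⟨g, rfl⟩)
    · have h1 : inner ℂ (mulZSq α β (mulBlaschke a ha g) : HardyH2)
          ((linGen α β : HardyH2) + mulZSq α β (c • szego a)) = 0 := by
        rw [inner_add_right, inner_mulZSq_linGen, zero_add, coe_mulZSq, coe_mulZSq,
          inner_mulZ_mulZ, inner_mulZ_mulZ, inner_smul_right, ← inner_conj_symm,
          inner_szego_mulBlaschke ha, map_zero, mul_zero]
      exact h1
    · intro h0
      have hpos : 0 < 1 - ‖a‖ ^ 2 := by nlinarith [norm_nonneg a]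
      -- If `h₀` vanished, multiplying by `l - a` would give `conj a l = 1`, impossible since `|a| <
      -- 1` and `|l| = |α||β| ≤ 1/2`.
      have h1 : β * (1 - conj a * (α * conj β)) = 0 := by
        have haa : ((1 - ‖a‖ ^ 2 : ℝ) : ℂ) = 1 - a * conj a := by
          rw [Complex.mul_conj']
          push_cast
          rfl
        rw [haa] at hrel
        linear_combination (α * conj β - a) * h0 - hrel
      have h2 : conj a * (α * conj β) = 1 :=
        (sub_eq_zero.1 ((mul_eq_zero.1 h1).resolve_left hβ)).symm
      have h3 : ‖a‖ * (‖α‖ * ‖β‖) = 1 := by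
        have := congrArg norm h2
        simpa using this
      nlinarith [sq_nonneg (‖α‖ - ‖β‖), norm_nonneg a, mul_nonneg (norm_nonneg α) (norm_nonneg β)]

end HardyH2

theorem theorem5p6 :
    ∃ γ : ℝ, (∀ y : ℝ, y ^ 3 + 7 * y ^ 2 + 12 * y - 1 = 0 ↔ y = γ) ∧
      ∀ (α β : ℂ), α ≠ 0 → β ≠ 0 → ‖α‖ ^ 2 + ‖β‖ ^ 2 = 1 →
      ∀ (a : ℂ), 0 < ‖a‖ → ‖a‖ < 1 → a ≠ α * starRingEnd ℂ β →
      ∀ (M : Submodule ℂ (HardyH2.parametric α β)), IsClosed (M : Set (HardyH2.parametric α β)) →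
        (∀ f ∈ M, HardyH2.compressedShift α β f ∈ M) →
        HardyH2.IsAssociatedInner M (fun z : ℂ => (z - a) / (1 - starRingEnd ℂ a * z)) →
        ¬ HasWanderingSubspaceProperty (HardyH2.compressedShift α β) M →
        ‖β‖ ^ 2 < 1 / (4 + γ) := by
  obtain ⟨γ, hγ, h⟩ := exists_cubic_root
  refine ⟨γ, cubic_eq_zero_iff hγ h, ?_⟩
  intro α β hα hβ hαβ a _ ha hne M hM hT hθ hW
  have hα' := norm_pos_iff.2 hα
  have hβ' := norm_pos_iff.2 hβ
  refine lt_one_div_of_lt_mul_one_sub (l := ‖α * starRingEnd ℂ β‖) hγ h (by positivity)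
    (by nlinarith) ?_ (not_le.1 fun hle =>
      hW (HardyH2.hasWanderingSubspaceProperty_of_norm_le hβ hαβ ha hne hM hT hθ hle))
  rw [norm_mul, RCLike.norm_conj, mul_pow, ← hαβ]
  ring

end
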